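/- All graphs are finite and simple. A rooted tree $(T,r)$ is a tree $T$ with a distinguished vertex $r$, and a forest of rooted trees is a forest in which every connected component has exactly one distinguished vertex, its root. For a graph $X$ with a vertex coloring $c$, the quantum automorphism group $\mathrm{Qut}_c(X)$ is the compact matrix quantum group whose $C^*$-algebra $C(\mathrm{Qut}_c(X))$ is the universal unital $C^*$-algebra with generators $u_{ij}$, $i,j\in V(X)$, and relations $$u_{ij}=u_{ij}^*=u_{ij}^2,\qquad \sum_{k}u_{ik}=1=\sum_k u_{kj},$$ $$u_{ij}u_{kl}=0\ \text{ if exactly one of } ik\in E(X),\ jl\in E(X)\text{ holds},\qquad u_{ij}=0\ \text{ if } c(i)\neq c(j),$$ with comultiplication $\Delta: C(\mathrm{Qut}_c(X))\to C(\mathrm{Qut}_c(X))\otimes_{\min} C(\mathrm{Qut}_c(X))$, $\Delta(u_{ij})=\sum_k u_{ik}\otimes u_{kj}$. A forest of rooted trees is regarded as a colored graph in which all roots have one color and all other vertices have a second, different color; for a rooted tree $(T,r)$ one writes $\mathrm{Qut}_r(T)$ for its quantum automorphism group as a colored graph. Two compact quantum groups $\mathbb G,\mathbb H$ are isomorphic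 if there is a $*$-isomorphism $\varphi: C(\mathbb G)\to C(\mathbb H)$ with $\Delta_{\mathbb H}\circ\varphi=(\varphi\otimes\varphi)\circ\Delta_{\mathbb G}$. Lemma. Let $F$ be a forest of rooted trees, and let $\widetilde F$ be the rooted tree obtained from $F$ by adding one new vertex, connecting it to the roots of all the trees of $F$, and taking it as the root. Then $$\mathrm{Qut}_c(F)\cong \mathrm{Qut}_r(\widetilde F).$$ -/

import Mathlib

noncomputable section

open scoped TensorProduct

universe u v w

/-! ### C*-seminorms and their completions -/

/-- A C*-seminorm on a unital complex *-algebra: a submultiplicative seminorm `p` with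
`p (a* a) = p a ^ 2`. -/
structure CStarSeminorm (P : Type u) [Ring P] [StarRing P] [Algebra ℂ P]
    extends Seminorm ℂ P where
  mul_le' : ∀ a b : P, toFun (a * b) ≤ toFun a * toFun b
  star_mul_self' : ∀ a : P, toFun (star a * a) = toFun a * toFun a

namespace CStarSeminorm

section Basic

variable {P : Type u} [Ring P] [StarRing P] [Algebra ℂ P]

instance : CoeFun (CStarSeminorm P) (fun _ => P → ℝ) := ⟨fun p => p.toSeminorm⟩

theorem mul_le (p : CStarSeminorm P) (a b : P) : p (a * b) ≤ p a * p b := p.mul_le' a b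

theorem star_mul_self (p : CStarSeminorm P) (a : P) : p (star a * a) = p a * p a :=
  p.star_mul_self' a

theorem le_star (p : CStarSeminorm P) (a : P) : p a ≤ p (star a) := by
  have h1 := p.star_mul_self a
  have h2 := p.mul_le (star a) a
  have h3 : 0 ≤ p a := apply_nonneg p.toSeminorm a
  have h4 : 0 ≤ p (star a) := apply_nonneg p.toSeminorm (star a)
  by_contra! h
  nlinarith

theorem star_eq (p : CStarSeminorm P) (a : P) : p (star a) = p a :=
  le_antisymm (by simpa using p.le_star (star a)) (p.le_star a)

theorem le_one_of_projection (p : CStarSeminorm P) (a : P) (h1 : p (star a - a) = 0)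
    (h2 : p (a * a - a) = 0) : p a ≤ 1 := by
  have h3 : p (star a * a) ≤ p a := by
    have e : star a * a = ((star a - a) * a + (a * a - a)) + a := by noncomm_ring
    have i1 : p (star a * a) ≤ p ((star a - a) * a + (a * a - a)) + p a := by
      conv_lhs => rw [e]
      exact map_add_le_add p.toSeminorm _ _
    have i2 : p ((star a - a) * a + (a * a - a)) ≤ p ((star a - a) * a) + p (a * a - a) :=
      map_add_le_add p.toSeminorm _ _
    have i3 := p.mul_le (star a - a) a
    rw [h1, zero_mul] at i3
    linarith
  rw [p.star_mul_self] at h3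
  by_contra! h
  nlinarith

/-- The zero C*-seminorm. -/
def zero : CStarSeminorm P where
  toSeminorm := 0
  mul_le' a b := by
    change (0 : ℝ) ≤ 0 * 0
    simp
  star_mul_self' a := by
    change (0 : ℝ) = 0 * 0
    simp

/-- The C*-seminorm `a ↦ ‖f a‖` defined by a *-homomorphism `f` into a C*-algebra. -/
def ofStarAlgHom {B : Type v} [CStarAlgebra B] (f : P →⋆ₐ[ℂ] B) : CStarSeminorm P where
  toSeminorm := (normSeminorm ℂ B).comp f.toAlgHom.toLinearMap
  mul_le' a b := by
    change ‖f (a * b)‖ ≤ ‖f a‖ * ‖f b‖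
    rw [map_mul]
    exact norm_mul_le (f a) (f b)
  star_mul_self' a := by
    change ‖f (star a * a)‖ = ‖f a‖ * ‖f a‖
    rw [map_mul, map_star]
    exact CStarRing.norm_star_mul_self

@[simp]
theorem ofStarAlgHom_apply {B : Type v} [CStarAlgebra B] (f : P →⋆ₐ[ℂ] B) (a : P) :
    ofStarAlgHom f a = ‖f a‖ := rfl

/-- The pointwise supremum of a nonempty, pointwise bounded family of C*-seminorms. -/
def sup (S : Set (CStarSeminorm P)) (hne : S.Nonempty)
    (hS : ∀ a, BddAbove ((fun p : CStarSeminorm P => p a) '' S)) : CStarSeminorm P where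
  toFun a := sSup ((fun p : CStarSeminorm P => p a) '' S)
  map_zero' := by
    have : (fun p : CStarSeminorm P => p (0 : P)) '' S = {0} := by
      ext x
      obtain ⟨q, hq⟩ := hne
      simp only [Set.mem_image, Set.mem_singleton_iff]
      constructor
      · rintro ⟨p, _, rfl⟩
        exact map_zero p.toSeminorm
      · rintro rfl
        exact ⟨q, hq, map_zero q.toSeminorm⟩
    rw [this, csSup_singleton]
  add_le' a b := by
    apply csSup_le (hne.image _)
    rintro _ ⟨p, hp, rfl⟩
    exact (map_add_le_add p.toSeminorm a b).trans
      (add_le_add (le_csSup (hS a) ⟨p, hp, rfl⟩) (le_csSup (hS b) ⟨p, hp, rfl⟩))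
  neg' a := by
    congr 1
    apply Set.image_congr
    intro p _
    exact map_neg_eq_map p.toSeminorm a
  smul' c a := by
    rw [sSup_image', sSup_image', Real.mul_iSup_of_nonneg (norm_nonneg c)]
    congr 1
    funext p
    exact map_smul_eq_mul p.1.toSeminorm c a
  mul_le' a b := by
    apply csSup_le (hne.image _)
    rintro _ ⟨p, hp, rfl⟩
    have ha : p a ≤ sSup ((fun p : CStarSeminorm P => p a) '' S) := le_csSup (hS a) ⟨p, hp, rfl⟩
    have hb : p b ≤ sSup ((fun p : CStarSeminorm P => p b) '' S) := le_csSup (hS b) ⟨p, hp, rfl⟩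
    have ha0 : 0 ≤ p a := apply_nonneg p.toSeminorm a
    have hb0 : 0 ≤ p b := apply_nonneg p.toSeminorm b
    exact (p.mul_le a b).trans (mul_le_mul ha hb hb0 (ha0.trans ha))
  star_mul_self' a := by
    apply le_antisymm
    · apply csSup_le (hne.image _)
      rintro _ ⟨p, hp, rfl⟩
      have ha : p a ≤ sSup ((fun p : CStarSeminorm P => p a) '' S) := le_csSup (hS a) ⟨p, hp, rfl⟩
      have ha0 : 0 ≤ p a := apply_nonneg p.toSeminorm a
      exact (p.star_mul_self a).le.trans (mul_le_mul ha ha ha0 (ha0.trans ha))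
    · set M := sSup ((fun p : CStarSeminorm P => p (star a * a)) '' S) with hM
      have key : ∀ p ∈ S, p a ≤ Real.sqrt M := by
        intro p hp
        apply Real.le_sqrt_of_sq_le
        rw [sq, ← p.star_mul_self]
        exact le_csSup (hS _) ⟨p, hp, rfl⟩
      have hM0 : 0 ≤ M := by
        apply Real.sSup_nonneg
        rintro _ ⟨p, _, rfl⟩
        exact apply_nonneg p.toSeminorm _
      have h : sSup ((fun p : CStarSeminorm P => p a) '' S) ≤ Real.sqrt M := by
        apply csSup_le (hne.image _)
        rintro _ ⟨p, hp, rfl⟩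
        exact key p hp
      have h0 : 0 ≤ sSup ((fun p : CStarSeminorm P => p a) '' S) := by
        apply Real.sSup_nonneg
        rintro _ ⟨p, _, rfl⟩
        exact apply_nonneg p.toSeminorm _
      calc _ ≤ Real.sqrt M * Real.sqrt M := mul_le_mul h h h0 (Real.sqrt_nonneg _)
        _ = M := Real.mul_self_sqrt hM0

theorem le_sup {S : Set (CStarSeminorm P)} {hne : S.Nonempty}
    {hS : ∀ a, BddAbove ((fun p : CStarSeminorm P => p a) '' S)} {p : CStarSeminorm P}
    (hp : p ∈ S) (a : P) : p a ≤ sup S hne hS a :=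
  le_csSup (hS a) ⟨p, hp, rfl⟩

theorem sup_le {S : Set (CStarSeminorm P)} {hne : S.Nonempty}
    {hS : ∀ a, BddAbove ((fun p : CStarSeminorm P => p a) '' S)} {a : P} {r : ℝ}
    (h : ∀ p ∈ S, p a ≤ r) : sup S hne hS a ≤ r := by
  apply csSup_le (hne.image _)
  rintro _ ⟨p, hp, rfl⟩
  exact h p hp

end Basic

section Completion

variable {P : Type u} [Ring P] [StarRing P] [Algebra ℂ P]

/-- The algebra `P` regarded as a seminormed algebra via the C*-seminorm `p`. -/
def Carrier (_p : CStarSeminorm P) : Type u := P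

variable (p : CStarSeminorm P)

instance : Ring p.Carrier := inferInstanceAs (Ring P)

instance : StarRing p.Carrier := inferInstanceAs (StarRing P)

instance : Algebra ℂ p.Carrier := inferInstanceAs (Algebra ℂ P)

instance [StarModule ℂ P] : StarModule ℂ p.Carrier := inferInstanceAs (StarModule ℂ P)

instance : SeminormedRing p.Carrier where
  __ := (inferInstance : Ring p.Carrier)
  __ := (p.toAddGroupSeminorm.toSeminormedAddCommGroup : SeminormedAddCommGroup P)
  norm_mul_le a b := p.mul_le a b

instance : NormedAlgebra ℂ p.Carrier where
  norm_smul_le c a := (map_smul_eq_mul p.toSeminorm c a).le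

instance : NormedStarGroup p.Carrier where
  norm_star_le a := (p.star_eq a).le

/-- The Hausdorff completion of a *-algebra `P` with respect to a C*-seminorm `p`; it is a
unital C*-algebra. -/
def Completion : Type u := UniformSpace.Completion p.Carrier

instance : NormedRing p.Completion := inferInstanceAs (NormedRing (UniformSpace.Completion p.Carrier))

instance : CompleteSpace p.Completion :=
  inferInstanceAs (CompleteSpace (UniformSpace.Completion p.Carrier))

instance : Algebra ℂ p.Completion :=
  inferInstanceAs (Algebra ℂ (UniformSpace.Completion p.Carrier))

instance : NormedAlgebra ℂ p.Completion where
  norm_smul_le c a := by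
    exact norm_smul_le (β := UniformSpace.Completion p.Carrier) c a

/-- The canonical ring homomorphism of `P` into its completion. -/
def coeRingHom : P →+* p.Completion :=
  (UniformSpace.Completion.coeRingHom : p.Carrier →+* UniformSpace.Completion p.Carrier)

theorem norm_coeRingHom (a : P) : ‖p.coeRingHom a‖ = p a :=
  UniformSpace.Completion.norm_coe (E := p.Carrier) a

theorem denseRange_coeRingHom : DenseRange p.coeRingHom :=
  UniformSpace.Completion.denseRange_coe (α := p.Carrier)

theorem induction_on {motive : p.Completion → Prop} (x : p.Completion)
    (hc : IsClosed {x | motive x}) (h : ∀ a : P, motive (p.coeRingHom a)) : motive x :=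
  UniformSpace.Completion.induction_on (α := p.Carrier) x hc h

theorem induction_on₂ {motive : p.Completion → p.Completion → Prop} (x y : p.Completion)
    (hc : IsClosed {x : p.Completion × p.Completion | motive x.1 x.2})
    (h : ∀ a b : P, motive (p.coeRingHom a) (p.coeRingHom b)) : motive x y :=
  UniformSpace.Completion.induction_on₂ (α := p.Carrier) (β := p.Carrier) x y hc h

instance : Star p.Completion where
  star := UniformSpace.Completion.map (star : p.Carrier → p.Carrier)

theorem continuous_star' : Continuous (star : p.Completion → p.Completion) :=
  UniformSpace.Completion.continuous_map

theorem coeRingHom_smul (c : ℂ) (a : P) : p.coeRingHom (c • a) = c • p.coeRingHom a :=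
  UniformSpace.Completion.coe_smul (X := p.Carrier) c a

variable [StarModule ℂ P]

theorem star_coeRingHom (a : P) : star (p.coeRingHom a) = p.coeRingHom (star a) := by
  refine UniformSpace.Completion.map_coe (α := p.Carrier) (β := p.Carrier) ?_ a
  exact (starₗᵢ ℂ (E := p.Carrier)).isometry.uniformContinuous

instance : ContinuousStar p.Completion := ⟨p.continuous_star'⟩

instance : StarRing p.Completion where
  star_involutive x := by
    refine p.induction_on (motive := fun x => star (star x) = x) x
      (isClosed_eq (by fun_prop) (by fun_prop)) fun a => ?_
    simp only [star_coeRingHom, star_star]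
  star_mul x y := by
    refine p.induction_on₂ (motive := fun x y => star (x * y) = star y * star x) x y
      (isClosed_eq (by fun_prop) (by fun_prop)) fun a b => ?_
    simp only [star_coeRingHom, ← map_mul, star_mul]
  star_add x y := by
    refine p.induction_on₂ (motive := fun x y => star (x + y) = star x + star y) x y
      (isClosed_eq (by fun_prop) (by fun_prop)) fun a b => ?_
    simp only [star_coeRingHom, ← map_add, star_add]

instance : StarModule ℂ p.Completion where
  star_smul c x := by
    have h1 : Continuous fun x : p.Completion => star (c • x) := by
      simp only [Algebra.smul_def]
      exact (continuous_const.mul continuous_id).star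
    have h2 : Continuous fun x : p.Completion => star c • star x := by
      simp only [Algebra.smul_def]
      exact continuous_const.mul continuous_star
    refine p.induction_on (motive := fun x => star (c • x) = star c • star x) x
      (isClosed_eq h1 h2) fun a => ?_
    simp only [star_coeRingHom, ← coeRingHom_smul, star_smul]

instance : CStarRing p.Completion where
  norm_mul_self_le x := by
    refine p.induction_on (motive := fun x => ‖x‖ * ‖x‖ ≤ ‖star x * x‖) x
      (isClosed_le (by fun_prop) (by fun_prop)) fun a => ?_
    simp only [star_coeRingHom, ← map_mul, norm_coeRingHom, star_mul_self, le_refl]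

instance : CStarAlgebra p.Completion where

/-- The canonical *-homomorphism of `P` into its completion. -/
def coe : P →⋆ₐ[ℂ] p.Completion where
  __ := p.coeRingHom
  commutes' _ := rfl
  map_star' a := (p.star_coeRingHom a).symm

theorem norm_coe (a : P) : ‖p.coe a‖ = p a := p.norm_coeRingHom a

theorem denseRange_coe : DenseRange p.coe := p.denseRange_coeRingHom

section Extend

variable {B : Type v} [CStarAlgebra B] (f : P →⋆ₐ[ℂ] B)

/-- Auxiliary: `f` as a ring homomorphism on `P` with the seminorm `p`. -/
def carrierRingHom : p.Carrier →+* B := f.toAlgHom.toRingHom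

theorem continuous_carrierRingHom (hf : ∀ a, ‖f a‖ ≤ p a) : Continuous (p.carrierRingHom f) :=
  AddMonoidHomClass.continuous_of_bound (p.carrierRingHom f) 1
    fun a => (hf a).trans (one_mul (p a)).ge

/-- Auxiliary: the extension to the completion as a ring homomorphism. -/
def extendRingHom (hf : ∀ a, ‖f a‖ ≤ p a) : p.Completion →+* B :=
  (UniformSpace.Completion.extensionHom (p.carrierRingHom f) (p.continuous_carrierRingHom f hf) :
    UniformSpace.Completion p.Carrier →+* B)

theorem extendRingHom_coe (hf : ∀ a, ‖f a‖ ≤ p a) (a : P) : p.extendRingHom f hf (p.coe a) = f a :=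
  UniformSpace.Completion.extensionHom_coe (p.carrierRingHom f)
    (p.continuous_carrierRingHom f hf) (a : p.Carrier)

theorem continuous_extendRingHom (hf : ∀ a, ‖f a‖ ≤ p a) : Continuous (p.extendRingHom f hf) :=
  UniformSpace.Completion.continuous_extension (α := p.Carrier)

/-- A *-homomorphism `f : P → B` into a C*-algebra with `‖f a‖ ≤ p a` extends to the
completion. -/
def extend (hf : ∀ a, ‖f a‖ ≤ p a) : p.Completion →⋆ₐ[ℂ] B where
  __ := p.extendRingHom f hf
  commutes' c := by
    change p.extendRingHom f hf (algebraMap ℂ p.Completion c) = _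
    rw [← AlgHomClass.commutes p.coe c, extendRingHom_coe, AlgHomClass.commutes]
  map_star' x := by
    have hE := p.continuous_extendRingHom f hf
    change p.extendRingHom f hf (star x) = star (p.extendRingHom f hf x)
    refine p.induction_on (motive := fun x =>
      p.extendRingHom f hf (star x) = star (p.extendRingHom f hf x)) x
      (isClosed_eq (hE.comp continuous_star) (continuous_star.comp hE)) fun a => ?_
    change p.extendRingHom f hf (star (p.coe a)) = star (p.extendRingHom f hf (p.coe a))
    rw [← map_star, extendRingHom_coe, extendRingHom_coe, map_star]

theorem extend_coe (hf : ∀ a, ‖f a‖ ≤ p a) (a : P) : p.extend f hf (p.coe a) = f a := p.extendRingHom_coe f hf a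

end Extend

end Completion

end CStarSeminorm

/-! ### The minimal (spatial) tensor product of C*-algebras -/

section MinTensor

variable {A : Type u} {B : Type u} [CStarAlgebra A] [CStarAlgebra B]

/-- The *-homomorphism on `A ⊗[ℂ] B` determined by a multiplicative, unital and *-preserving
bilinear map. -/
def starAlgHomOfBilin {C : Type v} [Ring C] [StarRing C] [Algebra ℂ C] (F : A →ₗ[ℂ] B →ₗ[ℂ] C)
    (hmul : ∀ a a' b b', F (a * a') (b * b') = F a b * F a' b') (hone : F 1 1 = 1)
    (hstar : ∀ a b, F (star a) (star b) = star (F a b)) : A ⊗[ℂ] B →⋆ₐ[ℂ] C where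
  __ := Algebra.TensorProduct.algHomOfLinearMapTensorProduct (TensorProduct.lift F) hmul hone
  map_star' x := by
    change TensorProduct.lift F (star x) = star (TensorProduct.lift F x)
    induction x with
    | zero => rw [star_zero, map_zero, star_zero]
    | add x y hx hy => rw [star_add, map_add, hx, hy, map_add, star_add]
    | tmul a b => exact hstar a b

theorem starAlgHomOfBilin_tmul {C : Type v} [Ring C] [StarRing C] [Algebra ℂ C]
    (F : A →ₗ[ℂ] B →ₗ[ℂ] C) (hmul : ∀ a a' b b', F (a * a') (b * b') = F a b * F a' b')
    (hone : F 1 1 = 1) (hstar : ∀ a b, F (star a) (star b) = star (F a b)) (a : A) (b : B) :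
    starAlgHomOfBilin F hmul hone hstar (a ⊗ₜ[ℂ] b) = F a b := rfl

section Spatial

variable {H : Type u} [NormedAddCommGroup H] [InnerProductSpace ℂ H] [CompleteSpace H]
  {K : Type u} [NormedAddCommGroup K] [InnerProductSpace ℂ K] [CompleteSpace K]

/-- The operator `S ⊗ T` on the Hilbert space tensor product, i.e. on the completion of the
algebraic tensor product `H ⊗[ℂ] K`. -/
def tensorOp (S : H →L[ℂ] H) (T : K →L[ℂ] K) :
    UniformSpace.Completion (H ⊗[ℂ] K) →L[ℂ] UniformSpace.Completion (H ⊗[ℂ] K) :=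
  (TensorProduct.mapL S T).completion

theorem tensorOp_coe (S : H →L[ℂ] H) (T : K →L[ℂ] K) (x : H ⊗[ℂ] K) :
    tensorOp S T x = (TensorProduct.mapL S T x : H ⊗[ℂ] K) :=
  ContinuousLinearMap.completion_apply_coe _ x

theorem completion_clm_ext {f g : UniformSpace.Completion (H ⊗[ℂ] K) →L[ℂ]
    UniformSpace.Completion (H ⊗[ℂ] K)} (h : ∀ x : H ⊗[ℂ] K, f x = g x) : f = g := by
  ext x
  refine UniformSpace.Completion.induction_on x (isClosed_eq f.continuous g.continuous) h

theorem tensorOp_mul (S S' : H →L[ℂ] H) (T T' : K →L[ℂ] K) :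
    tensorOp (S * S') (T * T') = tensorOp S T * tensorOp S' T' := by
  apply completion_clm_ext
  intro x
  simp only [mul_apply_eq_comp, tensorOp_coe, TensorProduct.mapL_mul]

theorem tensorOp_one : tensorOp (1 : H →L[ℂ] H) (1 : K →L[ℂ] K) = 1 := by
  apply completion_clm_ext
  intro x
  rw [tensorOp_coe]
  congr 1
  exact congrArg (fun f => f x) (TensorProduct.mapL_id_id (𝕜 := ℂ) (E := H) (G := K))

theorem tensorOp_add_left (S S' : H →L[ℂ] H) (T : K →L[ℂ] K) :
    tensorOp (S + S') T = tensorOp S T + tensorOp S' T := by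
  apply completion_clm_ext
  intro x
  simp only [add_apply, tensorOp_coe, TensorProduct.mapL_add_left,
    UniformSpace.Completion.coe_add]

theorem tensorOp_add_right (S : H →L[ℂ] H) (T T' : K →L[ℂ] K) :
    tensorOp S (T + T') = tensorOp S T + tensorOp S T' := by
  apply completion_clm_ext
  intro x
  simp only [add_apply, tensorOp_coe, TensorProduct.mapL_add_right,
    UniformSpace.Completion.coe_add]

theorem tensorOp_smul_left (c : ℂ) (S : H →L[ℂ] H) (T : K →L[ℂ] K) :
    tensorOp (c • S) T = c • tensorOp S T := by
  apply completion_clm_ext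
  intro x
  simp only [smul_apply, tensorOp_coe, TensorProduct.mapL_smul_left,
    UniformSpace.Completion.coe_smul]

theorem tensorOp_smul_right (c : ℂ) (S : H →L[ℂ] H) (T : K →L[ℂ] K) :
    tensorOp S (c • T) = c • tensorOp S T := by
  apply completion_clm_ext
  intro x
  simp only [smul_apply, tensorOp_coe, TensorProduct.mapL_smul_right,
    UniformSpace.Completion.coe_smul]

theorem tensorOp_star (S : H →L[ℂ] H) (T : K →L[ℂ] K) :
    tensorOp (star S) (star T) = star (tensorOp S T) := by
  rw [ContinuousLinearMap.star_eq_adjoint, ContinuousLinearMap.star_eq_adjoint,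
    ContinuousLinearMap.star_eq_adjoint]
  refine (ContinuousLinearMap.eq_adjoint_iff _ _).mpr ?_
  intro x y
  refine UniformSpace.Completion.induction_on₂ x y
    (isClosed_eq (by fun_prop) (by fun_prop)) fun x y => ?_
  simp only [tensorOp_coe, UniformSpace.Completion.inner_coe]
  induction x with
  | zero => simp
  | add x x' hx hx' => simp only [map_add, inner_add_left, hx, hx']
  | tmul a b =>
    induction y with
    | zero => simp
    | add y y' hy hy' => simp only [map_add, inner_add_right, hy, hy']
    | tmul c d =>
      simp [ContinuousLinearMap.adjoint_inner_left]

theorem norm_tensorOp_le (S : H →L[ℂ] H) (T : K →L[ℂ] K) : ‖tensorOp S T‖ ≤ ‖S‖ * ‖T‖ := by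
  refine ContinuousLinearMap.opNorm_le_bound _ (by positivity) fun x => ?_
  refine UniformSpace.Completion.induction_on x
    (isClosed_le (by fun_prop) (by fun_prop)) fun x => ?_
  rw [tensorOp_coe, UniformSpace.Completion.norm_coe, UniformSpace.Completion.norm_coe]
  exact ((TensorProduct.mapL S T).le_opNorm x).trans
    (mul_le_mul_of_nonneg_right (TensorProduct.norm_mapL_le S T) (norm_nonneg x))

/-- The tensor product representation `π ⊗ ρ` of the algebraic tensor product `A ⊗[ℂ] B` on the
Hilbert space tensor product of `H` and `K`. -/
def tensorRep (π : A →⋆ₐ[ℂ] (H →L[ℂ] H)) (ρ : B →⋆ₐ[ℂ] (K →L[ℂ] K)) :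
    A ⊗[ℂ] B →⋆ₐ[ℂ]
      (UniformSpace.Completion (H ⊗[ℂ] K) →L[ℂ] UniformSpace.Completion (H ⊗[ℂ] K)) :=
  starAlgHomOfBilin
    (LinearMap.mk₂ ℂ (fun a b => tensorOp (π a) (ρ b))
      (fun a a' b => by rw [map_add, tensorOp_add_left])
      (fun c a b => by rw [map_smul, tensorOp_smul_left])
      (fun a b b' => by rw [map_add, tensorOp_add_right])
      (fun c a b => by rw [map_smul, tensorOp_smul_right]))
    (fun a a' b b' => by simp only [LinearMap.mk₂_apply, map_mul, tensorOp_mul])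
    (by simp only [LinearMap.mk₂_apply, map_one, tensorOp_one])
    (fun a b => by simp only [LinearMap.mk₂_apply, map_star, tensorOp_star])

theorem tensorRep_tmul (π : A →⋆ₐ[ℂ] (H →L[ℂ] H)) (ρ : B →⋆ₐ[ℂ] (K →L[ℂ] K)) (a : A) (b : B) :
    tensorRep π ρ (a ⊗ₜ[ℂ] b) = tensorOp (π a) (ρ b) :=
  starAlgHomOfBilin_tmul _ _ _ _ a b

/-- The C*-seminorm `x ↦ ‖(π ⊗ ρ) x‖` on `A ⊗[ℂ] B`. -/
def spatialSeminorm (π : A →⋆ₐ[ℂ] (H →L[ℂ] H)) (ρ : B →⋆ₐ[ℂ] (K →L[ℂ] K)) :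
    CStarSeminorm (A ⊗[ℂ] B) :=
  CStarSeminorm.ofStarAlgHom
    (B := UniformSpace.Completion (H ⊗[ℂ] K) →L[ℂ] UniformSpace.Completion (H ⊗[ℂ] K))
    (tensorRep π ρ)

theorem spatialSeminorm_apply (π : A →⋆ₐ[ℂ] (H →L[ℂ] H)) (ρ : B →⋆ₐ[ℂ] (K →L[ℂ] K))
    (x : A ⊗[ℂ] B) : spatialSeminorm π ρ x = ‖tensorRep π ρ x‖ := rfl

end Spatial

variable (A B)

/-- The C*-seminorms `x ↦ ‖(π ⊗ ρ) x‖` on `A ⊗[ℂ] B`, for `π` and `ρ` representations of `A` and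
`B` on Hilbert spaces. -/
def spatialSeminorms : Set (CStarSeminorm (A ⊗[ℂ] B)) :=
  {p | ∃ (H : Type u) (_ : NormedAddCommGroup H) (_ : InnerProductSpace ℂ H) (_ : CompleteSpace H)
      (K : Type u) (_ : NormedAddCommGroup K) (_ : InnerProductSpace ℂ K) (_ : CompleteSpace K)
      (π : A →⋆ₐ[ℂ] (H →L[ℂ] H)) (ρ : B →⋆ₐ[ℂ] (K →L[ℂ] K)),
      p = spatialSeminorm π ρ}

theorem spatialSeminorms_nonempty : (spatialSeminorms A B).Nonempty := by
  have h : ∀ (C : Type u) [CStarAlgebra C],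
      Nonempty (C →⋆ₐ[ℂ] (PUnit.{u + 1} →L[ℂ] PUnit.{u + 1})) := fun C _ =>
    ⟨{ toFun := fun _ => 0
       map_one' := Subsingleton.elim _ _
       map_mul' := fun _ _ => Subsingleton.elim _ _
       map_zero' := rfl
       map_add' := fun _ _ => Subsingleton.elim _ _
       commutes' := fun _ => Subsingleton.elim _ _
       map_star' := fun _ => Subsingleton.elim _ _ }⟩
  obtain ⟨π⟩ := h A
  obtain ⟨ρ⟩ := h B
  exact ⟨_, PUnit, inferInstance, inferInstance, inferInstance, PUnit, inferInstance,
    inferInstance, inferInstance, π, ρ, rfl⟩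

theorem spatialSeminorms_bddAbove (x : A ⊗[ℂ] B) :
    BddAbove ((fun p : CStarSeminorm (A ⊗[ℂ] B) => p x) '' spatialSeminorms A B) := by
  induction x with
  | zero =>
    refine ⟨0, ?_⟩
    rintro _ ⟨p, -, rfl⟩
    exact (map_zero p.toSeminorm).le
  | add x y hx hy =>
    obtain ⟨r, hr⟩ := hx
    obtain ⟨s, hs⟩ := hy
    refine ⟨r + s, ?_⟩
    rintro _ ⟨p, hp, rfl⟩
    exact (map_add_le_add p.toSeminorm x y).trans
      (add_le_add (hr ⟨p, hp, rfl⟩) (hs ⟨p, hp, rfl⟩))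
  | tmul a b =>
    refine ⟨‖a‖ * ‖b‖, ?_⟩
    rintro _ ⟨p, ⟨H, _, _, _, K, _, _, _, π, ρ, rfl⟩, rfl⟩
    change spatialSeminorm π ρ (a ⊗ₜ[ℂ] b) ≤ ‖a‖ * ‖b‖
    rw [spatialSeminorm_apply, tensorRep_tmul]
    exact (norm_tensorOp_le _ _).trans (mul_le_mul (NonUnitalStarAlgHom.norm_apply_le π a)
      (NonUnitalStarAlgHom.norm_apply_le ρ b) (norm_nonneg _) (norm_nonneg _))

/-- The minimal (spatial) C*-norm on `A ⊗[ℂ] B`: the supremum of `‖(π ⊗ ρ) x‖` over all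
representations `π` of `A` and `ρ` of `B` on Hilbert spaces. -/
def minSeminorm : CStarSeminorm (A ⊗[ℂ] B) :=
  CStarSeminorm.sup (spatialSeminorms A B) (spatialSeminorms_nonempty A B)
    (spatialSeminorms_bddAbove A B)

/-- The minimal tensor product of two unital C*-algebras. -/
abbrev MinTensor : Type u := (minSeminorm A B).Completion

variable {A B}

/-- The canonical *-homomorphism from the algebraic to the minimal tensor product. -/
def MinTensor.coe : A ⊗[ℂ] B →⋆ₐ[ℂ] MinTensor A B := (minSeminorm A B).coe

/-- The elementary tensor `a ⊗ b` in the minimal tensor product. -/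
def MinTensor.tmul (a : A) (b : B) : MinTensor A B := MinTensor.coe (a ⊗ₜ[ℂ] b)

variable {A' B' : Type u} [CStarAlgebra A'] [CStarAlgebra B']

/-- The *-homomorphism `f ⊗ g` on algebraic tensor products. -/
def algTensorMap (f : A →⋆ₐ[ℂ] A') (g : B →⋆ₐ[ℂ] B') : A ⊗[ℂ] B →⋆ₐ[ℂ] A' ⊗[ℂ] B' where
  __ := Algebra.TensorProduct.map f.toAlgHom g.toAlgHom
  map_star' x := by
    change Algebra.TensorProduct.map f.toAlgHom g.toAlgHom (star x)
      = star (Algebra.TensorProduct.map f.toAlgHom g.toAlgHom x)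
    induction x with
    | zero => simp
    | add x y hx hy => rw [star_add, map_add, hx, hy, map_add, star_add]
    | tmul a b =>
      rw [TensorProduct.star_tmul, Algebra.TensorProduct.map_tmul, Algebra.TensorProduct.map_tmul,
        TensorProduct.star_tmul]
      exact congrArg₂ _ (map_star f a) (map_star g b)

theorem algTensorMap_tmul (f : A →⋆ₐ[ℂ] A') (g : B →⋆ₐ[ℂ] B') (a : A) (b : B) :
    algTensorMap f g (a ⊗ₜ[ℂ] b) = f a ⊗ₜ[ℂ] g b := rfl

theorem minSeminorm_algTensorMap_le (f : A →⋆ₐ[ℂ] A') (g : B →⋆ₐ[ℂ] B') (x : A ⊗[ℂ] B) :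
    minSeminorm A' B' (algTensorMap f g x) ≤ minSeminorm A B x := by
  apply CStarSeminorm.sup_le
  rintro _ ⟨H, _, _, _, K, _, _, _, π, ρ, rfl⟩
  have e : ∀ x, tensorRep π ρ (algTensorMap f g x) = tensorRep (π.comp f) (ρ.comp g) x := by
    intro x
    induction x with
    | zero => simp
    | add x y hx hy => simp only [map_add, hx, hy]
    | tmul a b =>
      rw [algTensorMap_tmul, tensorRep_tmul, tensorRep_tmul]
      rfl
  rw [spatialSeminorm_apply, e]
  have hmem : spatialSeminorm (π.comp f) (ρ.comp g) ∈ spatialSeminorms A B :=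
    ⟨H, _, _, _, K, _, _, _, π.comp f, ρ.comp g, rfl⟩
  exact CStarSeminorm.le_sup hmem x

/-- The *-homomorphism `f ⊗ g` on minimal tensor products. -/
def MinTensor.map (f : A →⋆ₐ[ℂ] A') (g : B →⋆ₐ[ℂ] B') : MinTensor A B →⋆ₐ[ℂ] MinTensor A' B' :=
  (minSeminorm A B).extend (MinTensor.coe.comp (algTensorMap f g)) fun x =>
    ((minSeminorm A' B').norm_coe _).le.trans (minSeminorm_algTensorMap_le f g x)

theorem MinTensor.map_tmul (f : A →⋆ₐ[ℂ] A') (g : B →⋆ₐ[ℂ] B') (a : A) (b : B) :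
    MinTensor.map f g (MinTensor.tmul a b) = MinTensor.tmul (f a) (g b) :=
  (minSeminorm A B).extend_coe _ _ _

end MinTensor

/-! ### Universal C*-algebras given by generators and relations -/

/-- The free unital complex *-algebra on a set `X`: noncommutative polynomials in the letters
`(x, false)`, standing for `x`, and `(x, true)`, standing for `x*`. -/
abbrev FreeStarAlg (X : Type u) : Type u := MonoidAlgebra ℂ (FreeMonoid (X × Bool))

namespace FreeStarAlg

variable {X : Type u}

/-- The generator `x`. -/
def gen (x : X) : FreeStarAlg X := MonoidAlgebra.of ℂ _ (FreeMonoid.of (x, false))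

/-- The involution on words: reverse the word and exchange `x` and `x*`. -/
def starWord : FreeMonoid (X × Bool) →* (FreeMonoid (X × Bool))ᵐᵒᵖ :=
  FreeMonoid.lift fun y => MulOpposite.op (FreeMonoid.of (y.1, !y.2))

theorem commute_starHom (c : ℂ) (z : (FreeStarAlg X)ᵐᵒᵖ) :
    Commute (((algebraMap ℂ (FreeStarAlg X)ᵐᵒᵖ).comp (starRingEnd ℂ)) c) z :=
  Algebra.commutes (A := (FreeStarAlg X)ᵐᵒᵖ) (starRingEnd ℂ c) z

/-- The involution of the free *-algebra as a ring homomorphism to the opposite ring. -/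
def starHom : FreeStarAlg X →+* (FreeStarAlg X)ᵐᵒᵖ :=
  MonoidAlgebra.liftNCRingHom
    (((algebraMap ℂ (FreeStarAlg X)ᵐᵒᵖ)).comp (starRingEnd ℂ))
    ((MonoidHom.op (MonoidAlgebra.of ℂ (FreeMonoid (X × Bool)))).comp starWord)
    (fun c _ => commute_starHom c _)

instance : Star (FreeStarAlg X) where
  star a := (starHom a).unop

theorem star_def (a : FreeStarAlg X) : star a = (starHom a).unop := rfl

theorem starHom_single (w : FreeMonoid (X × Bool)) (c : ℂ) :
    starHom (MonoidAlgebra.single w c) = MulOpposite.op (MonoidAlgebra.single (starWord w).unop (star c)) := by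
  rw [starHom, MonoidAlgebra.liftNCRingHom_single]
  apply MulOpposite.unop_injective
  simp [MulOpposite.algebraMap_apply]

theorem star_smul' (c : ℂ) (a : FreeStarAlg X) : star (c • a) = star c • star a := by
  have h : starHom (algebraMap ℂ (FreeStarAlg X) c)
      = MulOpposite.op (algebraMap ℂ (FreeStarAlg X) (star c)) := by
    rw [MonoidAlgebra.coe_algebraMap]
    simp [starHom_single]
  rw [star_def, star_def, Algebra.smul_def, map_mul, h, MulOpposite.unop_mul, MulOpposite.unop_op,
    ← Algebra.commutes, ← Algebra.smul_def]

theorem star_of (w : FreeMonoid (X × Bool)) :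
    star (MonoidAlgebra.of ℂ (FreeMonoid (X × Bool)) w)
      = MonoidAlgebra.of ℂ _ (starWord w).unop := by
  rw [star_def, MonoidAlgebra.of_apply, starHom_single]
  simp

theorem starWord_starWord (w : FreeMonoid (X × Bool)) :
    (starWord (starWord w).unop).unop = w := by
  induction w using FreeMonoid.inductionOn' with
  | one => simp
  | of_mul y w ih =>
    rw [map_mul, MulOpposite.unop_mul, map_mul, MulOpposite.unop_mul, ih]
    simp [starWord]

instance : StarRing (FreeStarAlg X) where
  star_involutive a := by
    induction a using MonoidAlgebra.induction_on with
    | of w => rw [star_of, star_of, starWord_starWord]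
    | add a b ha hb =>
      have h : ∀ a b : FreeStarAlg X, star (a + b) = star a + star b := fun a b => by
        simp only [star_def, map_add, MulOpposite.unop_add]
      rw [h, h, ha, hb]
    | smul c a ha => rw [star_smul', star_smul', ha, star_star]
  star_mul a b := by
    simp only [star_def, map_mul, MulOpposite.unop_mul]
  star_add a b := by
    simp only [star_def, map_add, MulOpposite.unop_add]

instance : StarModule ℂ (FreeStarAlg X) := ⟨star_smul'⟩

theorem of_true (x : X) :
    MonoidAlgebra.of ℂ _ (FreeMonoid.of (x, true)) = star (gen x) := by
  rw [gen, star_of]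
  simp [starWord]

section Lift

variable {B : Type v} [Ring B] [StarRing B] [Algebra ℂ B] [StarModule ℂ B]

/-- The value of a letter under an assignment `f` of the generators. -/
def letter (f : X → B) (y : X × Bool) : B := if y.2 then star (f y.1) else f y.1

theorem lift_starWord (f : X → B) (w : FreeMonoid (X × Bool)) :
    FreeMonoid.lift (letter f) (starWord w).unop = star (FreeMonoid.lift (letter f) w) := by
  induction w using FreeMonoid.inductionOn' with
  | one => simp
  | of_mul y w ih =>
    obtain ⟨x, b⟩ := y
    rw [map_mul, MulOpposite.unop_mul, map_mul, ih, map_mul, star_mul]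
    cases b <;> simp [starWord, letter]

/-- The *-homomorphism on the free *-algebra which evaluates the generators at `f`. -/
def lift (f : X → B) : FreeStarAlg X →⋆ₐ[ℂ] B where
  __ := MonoidAlgebra.lift ℂ B (FreeMonoid (X × Bool)) (FreeMonoid.lift (letter f))
  map_star' a := by
    change MonoidAlgebra.lift ℂ B (FreeMonoid (X × Bool)) (FreeMonoid.lift (letter f)) (star a)
      = star (MonoidAlgebra.lift ℂ B (FreeMonoid (X × Bool)) (FreeMonoid.lift (letter f)) a)
    induction a using MonoidAlgebra.induction_on with
    | of w => rw [star_of, MonoidAlgebra.lift_of, MonoidAlgebra.lift_of, lift_starWord]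
    | add a b ha hb => rw [star_add, map_add, ha, hb, map_add, star_add]
    | smul c a ha => rw [star_smul, map_smul, ha, map_smul, star_smul]

@[simp]
theorem lift_gen (f : X → B) (x : X) : lift f (gen x) = f x := by
  change MonoidAlgebra.lift ℂ B (FreeMonoid (X × Bool)) (FreeMonoid.lift (letter f)) (gen x) = _
  rw [gen, MonoidAlgebra.lift_of, FreeMonoid.lift_eval_of]
  simp [letter]

end Lift

/-- The free *-algebra is generated by the generators. -/
theorem mem_adjoin_gen (a : FreeStarAlg X) :
    a ∈ StarAlgebra.adjoin ℂ (Set.range (gen : X → FreeStarAlg X)) := by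
  induction a using MonoidAlgebra.induction_on with
  | of w =>
    induction w using FreeMonoid.inductionOn' with
    | one => rw [map_one]; exact one_mem _
    | of_mul y w ih =>
      rw [map_mul]
      refine mul_mem ?_ ih
      obtain ⟨x, b⟩ := y
      cases b
      · exact StarAlgebra.subset_adjoin ℂ _ ⟨x, rfl⟩
      · rw [of_true]
        exact star_mem (StarAlgebra.subset_adjoin ℂ _ ⟨x, rfl⟩)
  | add a b ha hb => exact add_mem ha hb
  | smul c a ha => exact SMulMemClass.smul_mem c ha

end FreeStarAlg

section Universal

variable {X : Type u}

/-- The C*-seminorms on the free *-algebra which vanish on a set `r` of relators. -/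
def relSeminorms (r : Set (FreeStarAlg X)) : Set (CStarSeminorm (FreeStarAlg X)) :=
  {p | ∀ a ∈ r, p a = 0}

theorem relSeminorms_nonempty (r : Set (FreeStarAlg X)) : (relSeminorms r).Nonempty :=
  ⟨CStarSeminorm.zero, fun _ _ => rfl⟩

/-- The relators `r` bound the norms of the generators. -/
def BoundedRelators (r : Set (FreeStarAlg X)) : Prop :=
  ∀ x : X, ∃ M : ℝ, ∀ p ∈ relSeminorms r, p (FreeStarAlg.gen x) ≤ M

theorem relSeminorms_bddAbove {r : Set (FreeStarAlg X)} (hr : BoundedRelators r)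
    (a : FreeStarAlg X) :
    BddAbove ((fun p : CStarSeminorm (FreeStarAlg X) => p a) '' relSeminorms r) := by
  suffices h : ∃ M : ℝ, ∀ p ∈ relSeminorms r, p a ≤ M by
    obtain ⟨M, hM⟩ := h
    refine ⟨M, ?_⟩
    rintro _ ⟨p, hp, rfl⟩
    exact hM p hp
  have hgen : ∀ y : X × Bool, ∃ M : ℝ, ∀ p ∈ relSeminorms r,
      p (MonoidAlgebra.of ℂ _ (FreeMonoid.of y)) ≤ M := by
    rintro ⟨x, b⟩
    obtain ⟨M, hM⟩ := hr x
    refine ⟨M, fun p hp => ?_⟩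
    cases b
    · exact hM p hp
    · rw [FreeStarAlg.of_true, p.star_eq]
      exact hM p hp
  induction a using MonoidAlgebra.induction_on with
  | of w =>
    induction w using FreeMonoid.inductionOn' with
    | one =>
      refine ⟨1, fun p _ => ?_⟩
      rw [map_one]
      apply p.le_one_of_projection
      · rw [star_one, sub_self]
        exact map_zero p.toSeminorm
      · rw [one_mul, sub_self]
        exact map_zero p.toSeminorm
    | of_mul y w ih =>
      obtain ⟨M, hM⟩ := ih
      obtain ⟨N, hN⟩ := hgen y
      refine ⟨N * M, fun p hp => ?_⟩
      rw [map_mul]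
      have h0 : 0 ≤ p (MonoidAlgebra.of ℂ _ (FreeMonoid.of y)) := apply_nonneg p.toSeminorm _
      exact (p.mul_le _ _).trans (mul_le_mul (hN p hp) (hM p hp)
        (apply_nonneg p.toSeminorm _) (h0.trans (hN p hp)))
  | add a b ha hb =>
    obtain ⟨M, hM⟩ := ha
    obtain ⟨N, hN⟩ := hb
    exact ⟨M + N, fun p hp => (map_add_le_add p.toSeminorm a b).trans
      (add_le_add (hM p hp) (hN p hp))⟩
  | smul c a ha =>
    obtain ⟨M, hM⟩ := ha
    refine ⟨‖c‖ * M, fun p hp => ?_⟩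
    have e : p (c • a) = ‖c‖ * p a := map_smul_eq_mul p.toSeminorm c a
    rw [e]
    exact mul_le_mul_of_nonneg_left (hM p hp) (norm_nonneg c)

variable (r : Set (FreeStarAlg X)) (hr : BoundedRelators r)

/-- The largest C*-seminorm on the free *-algebra which vanishes on the relators. -/
def universalSeminorm : CStarSeminorm (FreeStarAlg X) :=
  CStarSeminorm.sup (relSeminorms r) (relSeminorms_nonempty r) (relSeminorms_bddAbove hr)

/-- The universal C*-algebra generated by `X` subject to the relations `a = 0` for `a ∈ r`: the
completion of the free *-algebra in the largest C*-seminorm vanishing on `r`. -/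
abbrev UniversalCStar : Type u := (universalSeminorm r hr).Completion

variable {r}

/-- The generator `x` of the universal C*-algebra. -/
def UniversalCStar.gen (x : X) : UniversalCStar r hr :=
  (universalSeminorm r hr).coe (FreeStarAlg.gen x)

theorem UniversalCStar.adjoin_gen :
    (StarAlgebra.adjoin ℂ (Set.range (UniversalCStar.gen hr))).topologicalClosure = ⊤ := by
  rw [eq_top_iff]
  intro x _
  have hsub : Set.range (universalSeminorm r hr).coe
      ⊆ (StarAlgebra.adjoin ℂ (Set.range (UniversalCStar.gen hr)) :
        Set (UniversalCStar r hr)) := by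
    rintro _ ⟨a, rfl⟩
    have ha := FreeStarAlg.mem_adjoin_gen a
    have h : (universalSeminorm r hr).coe a ∈ (StarAlgebra.adjoin ℂ
        (Set.range (FreeStarAlg.gen : X → FreeStarAlg X))).map (universalSeminorm r hr).coe :=
      StarSubalgebra.mem_map.mpr ⟨a, ha, rfl⟩
    rw [StarAlgHom.map_adjoin, ← Set.range_comp] at h
    exact h
  exact closure_mono hsub ((universalSeminorm r hr).denseRange_coe x)

theorem UniversalCStar.coe_eq_zero {a : FreeStarAlg X} (ha : a ∈ r) :
    (universalSeminorm r hr).coe a = 0 := by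
  rw [← norm_eq_zero, CStarSeminorm.norm_coe]
  refine le_antisymm (CStarSeminorm.sup_le fun p hp => (hp a ha).le) ?_
  exact apply_nonneg (universalSeminorm r hr).toSeminorm a

theorem norm_lift_le_universalSeminorm {B : Type v} [CStarAlgebra B] (f : X → B)
    (hf : ∀ a ∈ r, FreeStarAlg.lift f a = 0) (a : FreeStarAlg X) :
    ‖FreeStarAlg.lift f a‖ ≤ universalSeminorm r hr a := by
  have hmem : CStarSeminorm.ofStarAlgHom (FreeStarAlg.lift f) ∈ relSeminorms r := fun b hb => by
    rw [CStarSeminorm.ofStarAlgHom_apply, hf b hb, norm_zero]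
  exact CStarSeminorm.le_sup hmem a

/-- The universal property: elements `f x` of a C*-algebra satisfying the relations define a
*-homomorphism. -/
def UniversalCStar.lift {B : Type v} [CStarAlgebra B] (f : X → B)
    (hf : ∀ a ∈ r, FreeStarAlg.lift f a = 0) : UniversalCStar r hr →⋆ₐ[ℂ] B :=
  (universalSeminorm r hr).extend (FreeStarAlg.lift f) (norm_lift_le_universalSeminorm hr f hf)

theorem UniversalCStar.lift_gen {B : Type v} [CStarAlgebra B] (f : X → B)
    (hf : ∀ a ∈ r, FreeStarAlg.lift f a = 0) (x : X) :
    UniversalCStar.lift hr f hf (UniversalCStar.gen hr x) = f x := by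
  rw [UniversalCStar.lift, UniversalCStar.gen, CStarSeminorm.extend_coe, FreeStarAlg.lift_gen]

end Universal

/-! ### Compact matrix quantum groups -/

/-- A compact matrix quantum group: a unital C*-algebra `C(G)` generated by the entries of a
matrix `u` such that `u` and `(u_ij*)` are invertible, with a unital *-homomorphism
`Δ : C(G) → C(G) ⊗ C(G)` satisfying `Δ(u_ij) = ∑ k, u_ik ⊗ u_kj`. -/
structure CompactMatrixQuantumGroup (n : Type u) [Fintype n] [DecidableEq n] where
  carrier : Type u
  [cstar : CStarAlgebra carrier]
  u : Matrix n n carrier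
  generates :
    (StarAlgebra.adjoin ℂ (Set.range fun ij : n × n => u ij.1 ij.2)).topologicalClosure = ⊤
  isUnit_u : IsUnit u
  isUnit_u_conj : IsUnit (u.map star)
  Δ : carrier →⋆ₐ[ℂ] MinTensor carrier carrier
  Δ_u : ∀ i j, Δ (u i j) = ∑ k, MinTensor.tmul (u i k) (u k j)

namespace CompactMatrixQuantumGroup

attribute [instance] CompactMatrixQuantumGroup.cstar

/-- Two compact matrix quantum groups are isomorphic as compact quantum groups if there is a
*-isomorphism of their C*-algebras which intertwines the comultiplications. (The fundamental
representations need not correspond, nor have the same size.) -/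
def IsIsomorphic {n m : Type u} [Fintype n] [DecidableEq n] [Fintype m] [DecidableEq m]
    (G : CompactMatrixQuantumGroup n) (H : CompactMatrixQuantumGroup m) : Prop :=
  ∃ φ : G.carrier ≃⋆ₐ[ℂ] H.carrier, ∀ a : G.carrier,
    H.Δ (φ a) = MinTensor.map (φ : G.carrier →⋆ₐ[ℂ] H.carrier) (φ : G.carrier →⋆ₐ[ℂ] H.carrier)
      (G.Δ a)

end CompactMatrixQuantumGroup

/-! ### Quantum automorphism groups of colored graphs -/

section Qut

variable {V : Type u} [Fintype V] {C : Type w} (X : SimpleGraph V) (c : V → C)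

/-- The relators of the quantum automorphism group of the graph `X` with vertex coloring `c`, in
the generators `u i j` for vertices `i` and `j`. -/
inductive QutRelator : FreeStarAlg (V × V) → Prop
  | selfAdjoint (i j : V) :
      QutRelator (star (FreeStarAlg.gen (i, j)) - FreeStarAlg.gen (i, j))
  | idempotent (i j : V) :
      QutRelator (FreeStarAlg.gen (i, j) * FreeStarAlg.gen (i, j) - FreeStarAlg.gen (i, j))
  | row_sum (i : V) : QutRelator (∑ k, FreeStarAlg.gen (i, k) - 1)
  | col_sum (j : V) : QutRelator (∑ k, FreeStarAlg.gen (k, j) - 1)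
  | adj_left (i j k l : V) (h : X.Adj i k) (h' : ¬ X.Adj j l) :
      QutRelator (FreeStarAlg.gen (i, j) * FreeStarAlg.gen (k, l))
  | adj_right (i j k l : V) (h : ¬ X.Adj i k) (h' : X.Adj j l) :
      QutRelator (FreeStarAlg.gen (i, j) * FreeStarAlg.gen (k, l))
  | color (i j : V) (h : c i ≠ c j) : QutRelator (FreeStarAlg.gen (i, j))

/-- A matrix with entries in a C*-algebra satisfying the relations of the quantum automorphism
group of the colored graph `(X, c)`. -/
structure IsQutMatrix {B : Type v} [CStarAlgebra B] (w : V → V → B) : Prop where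
  selfAdjoint : ∀ i j, star (w i j) = w i j
  idempotent : ∀ i j, w i j * w i j = w i j
  row_sum : ∀ i, ∑ k, w i k = 1
  col_sum : ∀ j, ∑ k, w k j = 1
  adj_left : ∀ i j k l, X.Adj i k → ¬ X.Adj j l → w i j * w k l = 0
  adj_right : ∀ i j k l, ¬ X.Adj i k → X.Adj j l → w i j * w k l = 0
  color : ∀ i j, c i ≠ c j → w i j = 0

variable {X c}

theorem IsQutMatrix.lift_eq_zero {B : Type v} [CStarAlgebra B] {w : V → V → B}
    (hw : IsQutMatrix X c w) : ∀ a ∈ {a | QutRelator X c a},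
      FreeStarAlg.lift (fun ij : V × V => w ij.1 ij.2) a = 0 := by
  rintro a (⟨i, j⟩ | ⟨i, j⟩ | i | j | ⟨i, j, k, l, h, h'⟩ | ⟨i, j, k, l, h, h'⟩ | ⟨i, j, h⟩)
  · simp [map_sub, map_star, hw.selfAdjoint]
  · simp [map_sub, hw.idempotent]
  · simp [map_sub, map_sum, hw.row_sum]
  · simp [map_sub, map_sum, hw.col_sum]
  · simp [hw.adj_left i j k l h h']
  · simp [hw.adj_right i j k l h h']
  · simp [hw.color i j h]

variable (X c)

theorem boundedRelators_qut : BoundedRelators {a | QutRelator X c a} := by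
  rintro ⟨i, j⟩
  exact ⟨1, fun p hp => p.le_one_of_projection _ (hp _ (.selfAdjoint i j))
    (hp _ (.idempotent i j))⟩

/-- The C*-algebra `C(Qut_c(X))`. -/
abbrev QutAlgebra : Type u := UniversalCStar {a | QutRelator X c a} (boundedRelators_qut X c)

/-- The generators `u i j` of `C(Qut_c(X))`. -/
def qutGen (i j : V) : QutAlgebra X c := UniversalCStar.gen (boundedRelators_qut X c) (i, j)

theorem isQutMatrix_qutGen : IsQutMatrix X c (qutGen X c) where
  selfAdjoint i j := by
    have h := UniversalCStar.coe_eq_zero (boundedRelators_qut X c) (QutRelator.selfAdjoint i j)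
    rwa [map_sub, map_star, sub_eq_zero] at h
  idempotent i j := by
    have h := UniversalCStar.coe_eq_zero (boundedRelators_qut X c) (QutRelator.idempotent i j)
    rwa [map_sub, map_mul, sub_eq_zero] at h
  row_sum i := by
    have h := UniversalCStar.coe_eq_zero (boundedRelators_qut X c) (QutRelator.row_sum i)
    rwa [map_sub, map_sum, map_one, sub_eq_zero] at h
  col_sum j := by
    have h := UniversalCStar.coe_eq_zero (boundedRelators_qut X c) (QutRelator.col_sum j)
    rwa [map_sub, map_sum, map_one, sub_eq_zero] at h
  adj_left i j k l h₁ h₂ := by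
    have h := UniversalCStar.coe_eq_zero (boundedRelators_qut X c)
      (QutRelator.adj_left i j k l h₁ h₂)
    rwa [map_mul] at h
  adj_right i j k l h₁ h₂ := by
    have h := UniversalCStar.coe_eq_zero (boundedRelators_qut X c)
      (QutRelator.adj_right i j k l h₁ h₂)
    rwa [map_mul] at h
  color i j h₁ := UniversalCStar.coe_eq_zero (boundedRelators_qut X c) (QutRelator.color i j h₁)

/-- The universal property of `C(Qut_c(X))`. -/
def qutLift {B : Type v} [CStarAlgebra B] (w : V → V → B) (hw : IsQutMatrix X c w) :
    QutAlgebra X c →⋆ₐ[ℂ] B :=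
  UniversalCStar.lift (boundedRelators_qut X c) (fun ij : V × V => w ij.1 ij.2) hw.lift_eq_zero

theorem qutLift_qutGen {B : Type v} [CStarAlgebra B] (w : V → V → B) (hw : IsQutMatrix X c w)
    (i j : V) : qutLift X c w hw (qutGen X c i j) = w i j :=
  UniversalCStar.lift_gen _ _ _ _

variable {X c}

/-- Projections in a C*-algebra which sum to `1` are pairwise orthogonal. -/
theorem projections_orthogonal {B : Type v} [CStarAlgebra B] {ι : Type w} [Fintype ι] (q : ι → B)
    (h1 : ∀ i, star (q i) = q i) (h2 : ∀ i, q i * q i = q i) (h3 : ∑ i, q i = 1) {i j : ι}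
    (hij : i ≠ j) : q i * q j = 0 := by
  classical
  let _ : PartialOrder B := CStarAlgebra.spectralOrder B
  have _ : StarOrderedRing B := CStarAlgebra.spectralOrderedRing B
  have e : ∀ k, star (q k * q j) * (q k * q j) = q j * q k * q j := by
    intro k
    rw [star_mul, h1, h1, mul_assoc, ← mul_assoc (q k), h2, mul_assoc]
  have hs : ∑ k, q j * q k * q j = q j := by
    rw [← Finset.sum_mul, ← Finset.mul_sum, h3, mul_one, h2]
  rw [← Finset.add_sum_erase _ _ (Finset.mem_univ j), h2, h2, add_eq_left] at hs
  have hz := (Finset.sum_eq_zero_iff_of_nonneg (fun k _ => by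
    rw [← e k]; exact star_mul_self_nonneg _)).mp hs i (by simp [hij])
  rw [← e i] at hz
  exact (CStarRing.star_mul_self_eq_zero_iff _).mp hz

theorem IsQutMatrix.row_orthogonal {B : Type v} [CStarAlgebra B] {w : V → V → B}
    (hw : IsQutMatrix X c w) (i : V) {j k : V} (hjk : j ≠ k) : w i j * w i k = 0 :=
  projections_orthogonal (fun j => w i j) (hw.selfAdjoint i) (hw.idempotent i) (hw.row_sum i) hjk

theorem IsQutMatrix.col_orthogonal {B : Type v} [CStarAlgebra B] {w : V → V → B}
    (hw : IsQutMatrix X c w) (k : V) {i j : V} (hij : i ≠ j) : w i k * w j k = 0 :=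
  projections_orthogonal (fun i => w i k) (fun i => hw.selfAdjoint i k)
    (fun i => hw.idempotent i k) (hw.col_sum k) hij

theorem IsQutMatrix.isUnit {B : Type v} [CStarAlgebra B] [DecidableEq V] {w : V → V → B}
    (hw : IsQutMatrix X c w) : IsUnit (Matrix.of w) := by
  refine isUnit_iff_exists.mpr ⟨Matrix.of fun i j => w j i, ?_, ?_⟩
  · ext i j
    rw [Matrix.mul_apply]
    simp only [Matrix.of_apply]
    by_cases h : i = j
    · subst h
      simp only [hw.idempotent, hw.row_sum, Matrix.one_apply_eq]
    · rw [Matrix.one_apply_ne h]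
      exact Finset.sum_eq_zero fun k _ => hw.col_orthogonal k h
  · ext i j
    rw [Matrix.mul_apply]
    simp only [Matrix.of_apply]
    by_cases h : i = j
    · subst h
      simp only [hw.idempotent, hw.col_sum, Matrix.one_apply_eq]
    · rw [Matrix.one_apply_ne h]
      exact Finset.sum_eq_zero fun k _ => hw.row_orthogonal k h

theorem MinTensor.tmul_mul_tmul {A B : Type u} [CStarAlgebra A] [CStarAlgebra B] (a a' : A)
    (b b' : B) : tmul a b * tmul a' b' = tmul (a * a') (b * b') := by
  rw [tmul, tmul, tmul, ← map_mul, Algebra.TensorProduct.tmul_mul_tmul]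

theorem MinTensor.star_tmul {A B : Type u} [CStarAlgebra A] [CStarAlgebra B] (a : A) (b : B) :
    star (tmul a b) = tmul (star a) (star b) := by
  rw [tmul, tmul, ← map_star, TensorProduct.star_tmul]

theorem MinTensor.zero_tmul {A B : Type u} [CStarAlgebra A] [CStarAlgebra B] (b : B) :
    tmul (0 : A) b = 0 := by
  rw [tmul, TensorProduct.zero_tmul, map_zero]

theorem MinTensor.tmul_zero {A B : Type u} [CStarAlgebra A] [CStarAlgebra B] (a : A) :
    tmul a (0 : B) = 0 := by
  rw [tmul, TensorProduct.tmul_zero, map_zero]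

theorem MinTensor.sum_tmul {A B : Type u} [CStarAlgebra A] [CStarAlgebra B] {ι : Type w}
    (s : Finset ι) (a : ι → A) (b : B) : ∑ i ∈ s, tmul (a i) b = tmul (∑ i ∈ s, a i) b := by
  simp only [tmul, ← map_sum, TensorProduct.sum_tmul]

theorem MinTensor.tmul_sum {A B : Type u} [CStarAlgebra A] [CStarAlgebra B] {ι : Type w}
    (s : Finset ι) (a : A) (b : ι → B) : ∑ i ∈ s, tmul a (b i) = tmul a (∑ i ∈ s, b i) := by
  simp only [tmul, ← map_sum, TensorProduct.tmul_sum]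

theorem MinTensor.tmul_one_one {A B : Type u} [CStarAlgebra A] [CStarAlgebra B] :
    tmul (1 : A) (1 : B) = 1 := by
  rw [tmul, ← Algebra.TensorProduct.one_def, map_one]

/-- If `w` satisfies the relations, then so does the matrix with entries `∑ k, w_ik ⊗ w_kj`. -/
theorem IsQutMatrix.comul {B : Type u} [CStarAlgebra B] {w : V → V → B}
    (hw : IsQutMatrix X c w) :
    IsQutMatrix X c fun i j => ∑ k, MinTensor.tmul (w i k) (w k j) where
  selfAdjoint i j := by simp only [star_sum, MinTensor.star_tmul, hw.selfAdjoint]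
  idempotent i j := by
    rw [Finset.sum_mul_sum]
    refine Finset.sum_congr rfl fun k _ => ?_
    rw [Finset.sum_eq_single k]
    · rw [MinTensor.tmul_mul_tmul, hw.idempotent, hw.idempotent]
    · intro l _ hl
      rw [MinTensor.tmul_mul_tmul, hw.row_orthogonal i hl.symm, MinTensor.zero_tmul]
    · simp
  row_sum i := by
    rw [Finset.sum_comm]
    simp only [MinTensor.tmul_sum, hw.row_sum, MinTensor.sum_tmul, MinTensor.tmul_one_one]
  col_sum j := by
    rw [Finset.sum_comm]
    simp only [MinTensor.sum_tmul, hw.col_sum, MinTensor.tmul_sum, MinTensor.tmul_one_one]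
  adj_left i j k l h h' := by
    rw [Finset.sum_mul_sum]
    refine Finset.sum_eq_zero fun m _ => Finset.sum_eq_zero fun n _ => ?_
    rw [MinTensor.tmul_mul_tmul]
    by_cases hmn : X.Adj m n
    · rw [hw.adj_left m j n l hmn h', MinTensor.tmul_zero]
    · rw [hw.adj_left i m k n h hmn, MinTensor.zero_tmul]
  adj_right i j k l h h' := by
    rw [Finset.sum_mul_sum]
    refine Finset.sum_eq_zero fun m _ => Finset.sum_eq_zero fun n _ => ?_
    rw [MinTensor.tmul_mul_tmul]
    by_cases hmn : X.Adj m n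
    · rw [hw.adj_right i m k n h hmn, MinTensor.zero_tmul]
    · rw [hw.adj_right m j n l hmn h', MinTensor.tmul_zero]
  color i j h := by
    refine Finset.sum_eq_zero fun m _ => ?_
    by_cases him : c i = c m
    · rw [hw.color m j fun hmj => h (him.trans hmj), MinTensor.tmul_zero]
    · rw [hw.color i m him, MinTensor.zero_tmul]

variable (X c)

/-- The quantum automorphism group `Qut_c(X)` of a graph `X` with vertex coloring `c`: the compact
matrix quantum group whose C*-algebra is the universal C*-algebra generated by the entries of a
magic unitary `u` with `u_ij u_kl = 0` whenever exactly one of `ik` and `jl` is an edge, and with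
`u_ij = 0` whenever `c i ≠ c j`. -/
def Qut [DecidableEq V] : CompactMatrixQuantumGroup V where
  carrier := QutAlgebra X c
  u := Matrix.of (qutGen X c)
  generates := UniversalCStar.adjoin_gen (boundedRelators_qut X c)
  isUnit_u := (isQutMatrix_qutGen X c).isUnit
  isUnit_u_conj := by
    have h : (Matrix.of (qutGen X c)).map star = Matrix.of (qutGen X c) := by
      ext i j
      exact (isQutMatrix_qutGen X c).selfAdjoint i j
    rw [h]
    exact (isQutMatrix_qutGen X c).isUnit
  Δ := qutLift X c _ (isQutMatrix_qutGen X c).comul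
  Δ_u i j := qutLift_qutGen X c _ (isQutMatrix_qutGen X c).comul i j

end Qut

/-! ### Rooted trees and forests of rooted trees -/

/-- A rooted tree with vertex set `V`. -/
structure SimpleGraph.RootedTree (V : Type u) where
  graph : SimpleGraph V
  isTree : graph.IsTree
  root : V

/-- A forest of rooted trees with vertex set `V`: an acyclic graph with a set of roots which meets
every connected component in exactly one vertex. -/
structure SimpleGraph.RootedForest (V : Type u) where
  graph : SimpleGraph V
  isAcyclic : graph.IsAcyclic
  roots : Set V
  existsUnique_root : ∀ K : graph.ConnectedComponent,
    ∃! r : V, r ∈ roots ∧ graph.connectedComponentMk r = K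

/-- The coloring of a rooted tree: the root has one color (`True`), all other vertices have
another color (`False`). -/
def SimpleGraph.RootedTree.coloring {V : Type u} (T : SimpleGraph.RootedTree V) : V → Prop := fun v => v = T.root

/-- The coloring of a forest of rooted trees: all roots have one color (`True`), all other vertices
have another color (`False`). -/
def SimpleGraph.RootedForest.coloring {V : Type u} (F : SimpleGraph.RootedForest V) : V → Prop := fun v => v ∈ F.roots

/-- The quantum automorphism group `Qut_r(T)` of a rooted tree. -/
def SimpleGraph.RootedTree.Qutr {V : Type u} [Fintype V] [DecidableEq V] (T : SimpleGraph.RootedTree V) :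
    CompactMatrixQuantumGroup V :=
  Qut T.graph T.coloring

/-- The colored quantum automorphism group `Qut_c(F)` of a forest of rooted trees. -/
def SimpleGraph.RootedForest.Qutc {V : Type u} [Fintype V] [DecidableEq V] (F : SimpleGraph.RootedForest V) :
    CompactMatrixQuantumGroup V :=
  Qut F.graph F.coloring

namespace SimpleGraph.RootedForest

variable {V : Type u} (F : RootedForest V)

/-- The graph obtained from `F` by adding a new vertex `none` and connecting it to all roots. -/
def joinGraph : SimpleGraph (Option V) where
  Adj
    | some a, some b => F.graph.Adj a b
    | some a, none => a ∈ F.roots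
    | none, some b => b ∈ F.roots
    | none, none => False
  symm := ⟨by
    rintro (_ | a) (_ | b) h
    · exact h
    · exact h
    · exact h
    · exact SimpleGraph.Adj.symm (G := F.graph) h⟩
  loopless := ⟨by
    rintro (_ | a) h
    · exact h
    · exact F.graph.loopless.irrefl a h⟩

theorem reachable_some {a b : V} (h : F.graph.Reachable a b) :
    F.joinGraph.Reachable (some a) (some b) := by
  let f : F.graph →g F.joinGraph := ⟨some, fun h => h⟩
  exact h.map f

theorem reachable_none (a : V) : F.joinGraph.Reachable (some a) none := by
  obtain ⟨r, ⟨hr, hra⟩, -⟩ := F.existsUnique_root (F.graph.connectedComponentMk a)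
  have h1 : F.graph.Reachable a r := (SimpleGraph.ConnectedComponent.exact hra).symm
  have h2 : F.joinGraph.Adj (some r) none := hr
  exact (F.reachable_some h1).trans h2.reachable

theorem joinGraph_connected : F.joinGraph.Connected := by
  have h : ∀ a, F.joinGraph.Reachable a none := by
    rintro (_ | a)
    · exact SimpleGraph.Reachable.refl _
    · exact F.reachable_none a
  exact ⟨fun a b => (h a).trans (h b).symm⟩

/-- A set of vertices which is closed under adjacency is closed under reachability. -/
theorem mem_of_reachable {W : Type u} {G : SimpleGraph W} {S : Set W}
    (hS : ∀ a b, G.Adj a b → a ∈ S → b ∈ S) {a b : W} (h : G.Reachable a b) (ha : a ∈ S) :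
    b ∈ S := by
  obtain ⟨p⟩ := h
  induction p with
  | nil => exact ha
  | cons hadj _ ih => exact ih (hS _ _ hadj ha)

theorem root_unique {r s : V} (hr : r ∈ F.roots) (hs : s ∈ F.roots)
    (h : F.graph.Reachable r s) : r = s :=
  (F.existsUnique_root (F.graph.connectedComponentMk s)).unique
    ⟨hr, SimpleGraph.ConnectedComponent.sound h⟩ ⟨hs, rfl⟩

theorem not_reachable_root_none {r : V} (hr : r ∈ F.roots) :
    ¬ (F.joinGraph.deleteEdges {s(some r, none)}).Reachable (some r) none := by
  intro h
  have hS : (none : Option V) ∈ {x | ∃ v, x = some v ∧ F.graph.Reachable r v} := by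
    refine mem_of_reachable ?_ h ⟨r, rfl, SimpleGraph.Reachable.refl _⟩
    rintro _ b hab ⟨v, rfl, hv⟩
    rw [SimpleGraph.deleteEdges_adj] at hab
    obtain ⟨hab, hne⟩ := hab
    rcases b with _ | b
    · have hvr : r = v := F.root_unique hr hab hv
      subst hvr
      exact absurd rfl hne
    · have hvb : F.graph.Adj v b := hab
      exact ⟨b, rfl, hv.trans hvb.reachable⟩
  obtain ⟨v, hv, -⟩ := hS
  exact absurd hv (by simp)

theorem not_reachable_some_some {a b : V}
    (hab : ¬ (F.graph.deleteEdges {s(a, b)}).Reachable a b)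
    (hroot : ∀ r ∈ F.roots, ¬ (F.graph.deleteEdges {s(a, b)}).Reachable a r) :
    ¬ (F.joinGraph.deleteEdges {s(some a, some b)}).Reachable (some a) (some b) := by
  intro h
  have hS : some b ∈ {x | ∃ v, x = some v ∧ (F.graph.deleteEdges {s(a, b)}).Reachable a v} := by
    refine mem_of_reachable ?_ h ⟨a, rfl, SimpleGraph.Reachable.refl _⟩
    rintro _ y hy ⟨v, rfl, hv⟩
    rw [SimpleGraph.deleteEdges_adj] at hy
    obtain ⟨hy, hne⟩ := hy
    rcases y with _ | y
    · exact absurd hv (hroot v hy)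
    · have hvy : F.graph.Adj v y := hy
      have hadj : (F.graph.deleteEdges {s(a, b)}).Adj v y := by
        rw [SimpleGraph.deleteEdges_adj]
        refine ⟨hvy, fun he => hne ?_⟩
        have he' : s(v, y) = s(a, b) := he
        have h2 := congrArg (Sym2.map (some : V → Option V)) he'
        simpa using h2
      exact ⟨y, rfl, hv.trans hadj.reachable⟩
  obtain ⟨v, hv, hav⟩ := hS
  obtain rfl : b = v := by simpa using hv
  exact hab hav

theorem joinGraph_isAcyclic : F.joinGraph.IsAcyclic := by
  rw [SimpleGraph.isAcyclic_iff_forall_adj_isBridge]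
  rintro (_ | a) (_ | b) h
  · exact absurd h (F.joinGraph.loopless.irrefl _)
  · rw [Sym2.eq_swap, SimpleGraph.isBridge_iff]
    exact F.not_reachable_root_none h
  · rw [SimpleGraph.isBridge_iff]
    exact F.not_reachable_root_none h
  · have hadj : F.graph.Adj a b := h
    have hb := SimpleGraph.isAcyclic_iff_forall_adj_isBridge.mp F.isAcyclic hadj
    rw [SimpleGraph.isBridge_iff] at hb
    by_cases hroot : ∀ r ∈ F.roots, ¬ (F.graph.deleteEdges {s(a, b)}).Reachable a r
    · rw [SimpleGraph.isBridge_iff]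
      exact F.not_reachable_some_some hb hroot
    · rw [Sym2.eq_swap, SimpleGraph.isBridge_iff]
      rw [Sym2.eq_swap] at hb hroot
      refine F.not_reachable_some_some (fun h => hb h.symm) fun s hs hbs => hroot ?_
      intro r hr har
      have hle := SimpleGraph.deleteEdges_le (G := F.graph) {s(b, a)}
      have hrs : r = s := F.root_unique hr hs
        (((har.mono hle).symm.trans hadj.reachable).trans (hbs.mono hle))
      subst hrs
      exact hb (har.trans hbs.symm)

/-- The rooted tree obtained by connecting the roots of the trees of `F` to a single new root. -/
def joinRoots : RootedTree (Option V) where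
  graph := F.joinGraph
  isTree := ⟨F.joinGraph_connected, F.joinGraph_isAcyclic⟩
  root := none

end SimpleGraph.RootedForest

end

/-! Write F̃ for `F.joinRoots`. The two universal C*-algebras present the same data: for every
C*-algebra B, the matrices over F̃ satisfying the quantum automorphism relations are exactly the
block diagonal matrices 1 ⊕ w, where w satisfies these relations over F.

In one direction, the new root `none` is the only vertex of its color in F̃. The color relation
therefore kills the rest of its row and column, the row sum makes its diagonal entry 1, and the
remaining block is again a magic unitary. The color relation of F̃ says nothing about that block,
since all its indices share one color. The distinction between roots and non-roots of F survives as
adjacency to `none`: if exactly one of i, j is a root, the edge relation gives u_ij · u_(none,none)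
= 0, and u_(none,none) = 1 forces u_ij = 0. This is `isQutMatrix_restrict`. Conversely, for 1 ⊕ w
the edge relations that involve `none` are precisely the color relations of w, which is
`isQutMatrix_extendMatrix`.

By the universal property, these two constructions give *-homomorphisms in both directions. Their
composites fix the generators, hence are identities. The comultiplications match because Δ(u_ij)
over F̃ has just one term more than over F, namely u_(i,none) ⊗ u_(none,j), and this term is zero.
-/

/-! ### Generators determine *-homomorphisms on C(Qut_c(X)) -/

section QutUniversal

variable {V : Type u} [Fintype V] {C : Type w} {X : SimpleGraph V} {c : V → C}

/-- Two *-homomorphisms on `C(Qut_c(X))` which agree on the generators are equal. -/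
theorem qutAlgebra_hom_ext {B : Type v} [CStarAlgebra B] {f g : QutAlgebra X c →⋆ₐ[ℂ] B}
    (h : ∀ i j, f (qutGen X c i j) = g (qutGen X c i j)) : f = g := by
  -- A *-homomorphism between C*-algebras is contractive, so continuity is automatic. It makes the
  -- equalizer of `f` and `g` a closed *-subalgebra.
  have hf : Continuous f :=
    AddMonoidHomClass.continuous_of_bound f 1 fun x => by
      rw [one_mul]
      exact NonUnitalStarAlgHom.norm_apply_le f x
  have hg : Continuous g :=
    AddMonoidHomClass.continuous_of_bound g 1 fun x => by
      rw [one_mul]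
      exact NonUnitalStarAlgHom.norm_apply_le g x
  have hle : StarAlgebra.adjoin ℂ (Set.range (UniversalCStar.gen (boundedRelators_qut X c)))
      ≤ StarAlgHom.equalizer f g := by
    refine StarAlgHom.adjoin_le_equalizer f g ?_
    rintro _ ⟨⟨i, j⟩, rfl⟩
    exact h i j
  -- The equalizer is closed and contains the *-algebra generated by the u_ij, which is dense, so it
  -- is everything.
  have hcl := StarSubalgebra.topologicalClosure_minimal hle (isClosed_eq hf hg)
  rw [UniversalCStar.adjoin_gen] at hcl
  ext x
  exact hcl (StarSubalgebra.mem_top (x := x))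

end QutUniversal

/-! ### Matrices satisfying the relations over F and over F̃ -/

namespace SimpleGraph.RootedForest

variable {V : Type u} (F : RootedForest V)

/-- The block diagonal matrix with blocks `1`, indexed by the vertex `none`, and `w`. -/
def extendMatrix {B : Type v} [Zero B] [One B] (w : V → V → B) : Option V → Option V → B
  | none, none => 1
  | some i, some j => w i j
  | _, _ => 0

variable [Fintype V] {F}

/-- Entries between `none` and an old vertex are 0, so a product in an edge relation can be nonzero
only if each factor is the entry 1 or an entry of `w`. If both are entries of `w`, the relation is
one for F. If both are 1, it is vacuous because `none` is not adjacent to itself. In the mixed case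
the relation concerns w_ij with exactly one of i, j a root, and this is the color relation of `w`.
-/
theorem isQutMatrix_extendMatrix {B : Type v} [CStarAlgebra B] {w : V → V → B}
    (hw : IsQutMatrix F.graph F.coloring w) :
    IsQutMatrix F.joinRoots.graph F.joinRoots.coloring (extendMatrix w) where
  selfAdjoint := by
    rintro (_ | i) (_ | j) <;> simp [extendMatrix, hw.selfAdjoint]
  idempotent := by
    rintro (_ | i) (_ | j) <;> simp [extendMatrix, hw.idempotent]
  row_sum := by
    rintro (_ | i) <;> simp [extendMatrix, hw.row_sum]
  col_sum := by
    rintro (_ | i) <;> simp [extendMatrix, hw.col_sum]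
  adj_left := by
    -- This is the mixed case. Colors are propositions, so an equality of colors transports
    -- membership in `F.roots` from i to j.
    have hcol : ∀ i j, i ∈ F.roots → j ∉ F.roots → w i j = 0 := fun i j hi hj =>
      hw.color i j fun h => hj (h.mp hi)
    rintro (_ | i) (_ | j) (_ | k) (_ | l) h h' <;>
      simp_all [extendMatrix, joinRoots, joinGraph, hw.adj_left]
  adj_right := by
    -- The mixed case again, with the edge now on the side of the column indices.
    have hcol : ∀ i j, i ∉ F.roots → j ∈ F.roots → w i j = 0 := fun i j hi hj =>
      hw.color i j fun h => hi (h.mpr hj)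
    rintro (_ | i) (_ | j) (_ | k) (_ | l) h h' <;>
      simp_all [extendMatrix, joinRoots, joinGraph, hw.adj_right]
  color := by
    rintro (_ | i) (_ | j) h <;> simp_all [extendMatrix, RootedTree.coloring, joinRoots]

/-- The new root shares its color with no other vertex. This lemma and the next two show that every
matrix for F̃ is block diagonal with 1 in the corner. -/
theorem isQutMatrix_joinRoots_some_none {B : Type v} [CStarAlgebra B]
    {w : Option V → Option V → B}
    (hw : IsQutMatrix F.joinRoots.graph F.joinRoots.coloring w) (i : V) : w (some i) none = 0 :=
  hw.color _ _ fun h => Option.some_ne_none i (h.mpr rfl)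

theorem isQutMatrix_joinRoots_none_some {B : Type v} [CStarAlgebra B]
    {w : Option V → Option V → B}
    (hw : IsQutMatrix F.joinRoots.graph F.joinRoots.coloring w) (i : V) : w none (some i) = 0 :=
  hw.color _ _ fun h => Option.some_ne_none i (h.mp rfl)

/-- All other entries of this row vanish, so its sum, which is 1, is the diagonal entry. -/
theorem isQutMatrix_joinRoots_none_none {B : Type v} [CStarAlgebra B]
    {w : Option V → Option V → B}
    (hw : IsQutMatrix F.joinRoots.graph F.joinRoots.coloring w) : w none none = 1 := by
  have h := hw.row_sum none
  simpa [Fintype.sum_option, isQutMatrix_joinRoots_none_some hw] using h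

/-- Deleting the row and column of `none` removes only zeros from the other row and column sums, and
F is the subgraph of F̃ induced on the old vertices. Only the color relation of F needs an argument:
it comes from the edges between the old roots and `none`. -/
theorem isQutMatrix_restrict {B : Type v} [CStarAlgebra B] {w : Option V → Option V → B}
    (hw : IsQutMatrix F.joinRoots.graph F.joinRoots.coloring w) :
    IsQutMatrix F.graph F.coloring fun i j => w (some i) (some j) where
  selfAdjoint _ _ := hw.selfAdjoint _ _
  idempotent _ _ := hw.idempotent _ _
  row_sum i := by
    simpa [Fintype.sum_option, isQutMatrix_joinRoots_some_none hw] using hw.row_sum (some i)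
  col_sum j := by
    simpa [Fintype.sum_option, isQutMatrix_joinRoots_none_some hw] using hw.col_sum (some j)
  -- Between old vertices, adjacency in F̃ is adjacency in F by definition.
  adj_left i j k l h h' := hw.adj_left (some i) (some j) (some k) (some l) h h'
  adj_right i j k l h h' := hw.adj_right (some i) (some j) (some k) (some l) h h'
  color i j h := by
    -- Different colors mean that exactly one of i, j is a root, so exactly one of the pairs (i,
    -- `none`), (j, `none`) is an edge of F̃. Since `w none none` is 1, the vanishing product is
    -- w_ij itself.
    have hij : w (some i) (some j) * w none none = 0 := by
      by_cases hi : i ∈ F.roots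
      · have hj : j ∉ F.roots := fun hj => h (propext ⟨fun _ => hj, fun _ => hi⟩)
        exact hw.adj_left (some i) (some j) none none hi hj
      · have hj : j ∈ F.roots := by
          by_contra hj
          exact h (propext ⟨fun h => absurd h hi, fun h => absurd h hj⟩)
        exact hw.adj_right (some i) (some j) none none hi hj
    rwa [isQutMatrix_joinRoots_none_none hw, mul_one] at hij

/-! ### The mutually inverse *-homomorphisms -/

variable (F)

/-- The *-homomorphism `C(Qut_c(F)) → C(Qut_r(F̃))` which sends `u_ij` to `u_ij`. -/
noncomputable def qutToJoinRoots : QutAlgebra F.graph F.coloring →⋆ₐ[ℂ]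
    QutAlgebra F.joinRoots.graph F.joinRoots.coloring :=
  qutLift _ _ _ (isQutMatrix_restrict (isQutMatrix_qutGen _ _))

/-- The *-homomorphism `C(Qut_r(F̃)) → C(Qut_c(F))` which sends `u` to the block diagonal matrix
with blocks `1` and `u`. -/
noncomputable def qutOfJoinRoots : QutAlgebra F.joinRoots.graph F.joinRoots.coloring →⋆ₐ[ℂ]
    QutAlgebra F.graph F.coloring :=
  qutLift _ _ _ (isQutMatrix_extendMatrix (isQutMatrix_qutGen _ _))

theorem qutToJoinRoots_qutGen (i j : V) : F.qutToJoinRoots (qutGen F.graph F.coloring i j)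
    = qutGen F.joinRoots.graph F.joinRoots.coloring (some i) (some j) :=
  qutLift_qutGen _ _ _ _ i j

theorem qutOfJoinRoots_qutGen (i j : Option V) :
    F.qutOfJoinRoots (qutGen F.joinRoots.graph F.joinRoots.coloring i j)
      = extendMatrix (qutGen F.graph F.coloring) i j :=
  qutLift_qutGen _ _ _ _ i j

/-- The lower block of 1 ⊕ u is u, so every generator returns to itself. -/
theorem qutOfJoinRoots_comp_qutToJoinRoots :
    F.qutOfJoinRoots.comp F.qutToJoinRoots = StarAlgHom.id ℂ _ :=
  qutAlgebra_hom_ext fun i j => by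
    rw [StarAlgHom.comp_apply, qutToJoinRoots_qutGen, qutOfJoinRoots_qutGen]
    rfl

/-- The generators indexed by `none` are replaced by the constants 0 and 1 on the way. Nothing is
lost, because the relations of F̃ already force these values. -/
theorem qutToJoinRoots_comp_qutOfJoinRoots :
    F.qutToJoinRoots.comp F.qutOfJoinRoots = StarAlgHom.id ℂ _ :=
  qutAlgebra_hom_ext fun i j => by
    have hw := isQutMatrix_qutGen F.joinRoots.graph F.joinRoots.coloring
    rw [StarAlgHom.comp_apply, qutOfJoinRoots_qutGen]
    rcases i with _ | i <;> rcases j with _ | j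
    · exact (map_one _).trans (isQutMatrix_joinRoots_none_none hw).symm
    · exact (map_zero _).trans (isQutMatrix_joinRoots_none_some hw j).symm
    · exact (map_zero _).trans (isQutMatrix_joinRoots_some_none hw i).symm
    · exact F.qutToJoinRoots_qutGen i j

/-- The *-isomorphism `C(Qut_c(F)) ≃ C(Qut_r(F̃))`. -/
noncomputable def qutEquivJoinRoots : QutAlgebra F.graph F.coloring ≃⋆ₐ[ℂ]
    QutAlgebra F.joinRoots.graph F.joinRoots.coloring :=
  StarAlgEquiv.ofStarAlgHom F.qutToJoinRoots F.qutOfJoinRoots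
    F.qutOfJoinRoots_comp_qutToJoinRoots F.qutToJoinRoots_comp_qutOfJoinRoots

/-! ### Compatibility with the comultiplications -/

/-- Both sides are *-homomorphisms, so comparing them on generators suffices. There they are the
sums of u_ik ⊗ u_kj over the vertices k of F̃ and of F respectively, and the term k = `none`
vanishes. -/
theorem comul_comp_qutToJoinRoots [DecidableEq V] :
    (Qut F.joinRoots.graph F.joinRoots.coloring).Δ.comp F.qutToJoinRoots
      = (MinTensor.map F.qutToJoinRoots F.qutToJoinRoots).comp
        (Qut F.graph F.coloring).Δ :=
  qutAlgebra_hom_ext fun i j => by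
    have hw := isQutMatrix_qutGen F.joinRoots.graph F.joinRoots.coloring
    have h₁ : (Qut F.joinRoots.graph F.joinRoots.coloring).Δ
        (F.qutToJoinRoots (qutGen F.graph F.coloring i j))
        = ∑ k, MinTensor.tmul (qutGen F.joinRoots.graph F.joinRoots.coloring (some i) k)
            (qutGen F.joinRoots.graph F.joinRoots.coloring k (some j)) := by
      rw [qutToJoinRoots_qutGen]
      exact (Qut F.joinRoots.graph F.joinRoots.coloring).Δ_u (some i) (some j)
    have h₂ : MinTensor.map F.qutToJoinRoots F.qutToJoinRoots
        (∑ k, MinTensor.tmul (qutGen F.graph F.coloring i k) (qutGen F.graph F.coloring k j))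
        = ∑ k, MinTensor.tmul (qutGen F.joinRoots.graph F.joinRoots.coloring (some i) k)
            (qutGen F.joinRoots.graph F.joinRoots.coloring k (some j)) := by
      -- The term of the new root is split off; its left factor u_(i,none) is zero.
      rw [Fintype.sum_option, isQutMatrix_joinRoots_some_none hw, MinTensor.zero_tmul, zero_add]
      simp only [map_sum, MinTensor.map_tmul, qutToJoinRoots_qutGen]
    exact h₁.trans (h₂.symm.trans (congrArg (MinTensor.map F.qutToJoinRoots F.qutToJoinRoots)
      ((Qut F.graph F.coloring).Δ_u i j).symm))

end SimpleGraph.RootedForest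

theorem mainTheorem3 {V : Type*} [Fintype V] [DecidableEq V] (F : SimpleGraph.RootedForest V) :
    F.Qutc.IsIsomorphic F.joinRoots.Qutr :=
  -- The *-homomorphism underlying the equivalence is `F.qutToJoinRoots`, so the equality of
  -- composites, evaluated at `a`, is the intertwining condition.
  ⟨F.qutEquivJoinRoots, fun a => congrArg (fun f => f a) F.comul_comp_qutToJoinRoots⟩
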